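/- Let $r\ge 1$, let $P$ be a probability distribution on $[r]=\{1,\dots,r\}$ and let $W(\cdot\mid\cdot)$ be a discrete memoryless channel from $[r]$ to $[r]$. *Delay estimation* of length $n$: positions are indexed by $\mathbb Z/n\mathbb Z$, the set of possible delays is a set $\Pi$ of cyclic shifts $\pi(i)=i+d$ that contains the identity and at least one other shift, the delay $\pi$ is uniform on $\Pi$, the symbols $X_i$ are i.i.d. with law $P$, independent of $\pi$, and, given $X=x$ and $\pi$, the received symbols $Y_i$ are independent with $Y_i\sim W(\cdot\mid x_{\pi(i)})$. A maximum-likelihood decoder $\Phi_{\mathrm{ML}}$ returns a maximizer over $\pi\in\Pi$ of $\prod_i W(y_i\mid x_{\pi(i)})$ (ties are broken arbitrarily), and $P_e(\Phi)$ is the probability that $\Phi(X,Y)\ne\pi$. For a permutation $\pi$ let $\kappa_\pi$ be the number of its cycles, fixed points included. Then there is a real number $\mathcal E^*$, depending only on $P$ and $W$, with the following two properties. 1. $\mathcal E^*$ is the error exponent: $-\frac1{n}\log_2 P_e(\Phi_{\mathrm{ML}})\to\mathcal E^*$ along every sequence of delay estimation problems (with source $P$ and channel $W$) whose lengths $n$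 tend to infinity and for which $\max_{\pi\ne\pi'\in\Pi}\kappa_{\pi'^{-1}\circ\pi}=o(n/\log n)$. (If $\Pi$ is a group, this maximum is $\max_{\pi\in\Pi,\,\pi\neq \mathrm{id}}\kappa_\pi$.) 2. For every $n$, every set $\Pi$ of possible delays as above and every maximum-likelihood decoder, $P_e(\Phi_{\mathrm{ML}})>0$ and $$-\frac1n\log_2 P_e(\Phi_{\mathrm{ML}})\le \mathcal E^*+\frac{\kappa}{n}\,r^2\log_2\!\left(1+\frac n\kappa\right)-\frac{\kappa}{n}\log_2 r,$$ where $\kappa=\max_{\pi\in\Pi,\ \pi\ne\mathrm{id}}\kappa_\pi$ is the maximum number of permutation cycles of a non-identity possible delay. -/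

import Mathlib

open Filter Topology Asymptotics

noncomputable section

/-- The cyclic shift by `d` of the `n` positions, as a permutation: `i ↦ i + d (mod n)`. -/
def cyclicShift {n : ℕ} (d : ZMod n) : Equiv.Perm (ZMod n) := Equiv.addRight d

/-- The number of permutation cycles of `σ`; a fixed point counts as a cycle of length one. -/
def numCycles {α : Type*} (σ : Equiv.Perm α) : ℕ :=
  Nat.card (Quotient (Equiv.Perm.SameCycle.setoid σ))

/-- A set of possible delays: it contains the identity and at least one other delay, so that
there is something to estimate. -/
def IsDelaySet {n : ℕ} (D : Finset (ZMod n)) : Prop :=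
  (0 : ZMod n) ∈ D ∧ ∃ d ∈ D, d ≠ 0

/-- `κ`: the maximum number of permutation cycles of a non-identity possible delay. -/
def maxCycles {n : ℕ} (D : Finset (ZMod n)) : ℕ :=
  (D.erase 0).sup fun d => numCycles (cyclicShift d)

/-- The maximum number of permutation cycles of `π'⁻¹ ∘ π`, over distinct possible delays `π, π'`.
If the set of possible delays is a group, this is `maxCycles D`. -/
def maxRelCycles {n : ℕ} (D : Finset (ZMod n)) : ℕ :=
  D.offDiag.sup fun p => numCycles ((cyclicShift p.2)⁻¹ * cyclicShift p.1)

/-- The likelihood of the delay `d`: the conditional probability of receiving `y` when `x` is sent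
through the memoryless channel `W` (`W a b` is the probability of output `b` on input `a`), and
the output is then delayed by `d`, that is, `y i` is the channel output of the symbol
`x (i + d)`. -/
def likelihood {r n : ℕ} [NeZero n] (W : Fin r → Fin r → ℝ) (d : ZMod n)
    (x y : ZMod n → Fin r) : ℝ :=
  ∏ i, W (x (cyclicShift d i)) (y i)

/-- The joint probability of `(x, y)` given the delay `d`, the symbols of `x` being i.i.d. with
law `P`. -/
def jointProb {r n : ℕ} [NeZero n] (P : Fin r → ℝ) (W : Fin r → Fin r → ℝ) (d : ZMod n)
    (x y : ZMod n → Fin r) : ℝ :=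
  (∏ i, P (x i)) * likelihood W d x y

/-- A maximum-likelihood decoder for the delays in `D`, with an arbitrary rule to break ties. -/
def IsMLDecoder {r n : ℕ} [NeZero n] (W : Fin r → Fin r → ℝ) (D : Finset (ZMod n))
    (Φ : (ZMod n → Fin r) → (ZMod n → Fin r) → ZMod n) : Prop :=
  ∀ x y, Φ x y ∈ D ∧ ∀ d ∈ D, likelihood W d x y ≤ likelihood W (Φ x y) x y

/-- The error probability of the decoder `Φ`, for a delay that is uniform on `D`. -/
def errorProb {r n : ℕ} [NeZero n] (P : Fin r → ℝ) (W : Fin r → Fin r → ℝ) (D : Finset (ZMod n))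
    (Φ : (ZMod n → Fin r) → (ZMod n → Fin r) → ZMod n) : ℝ :=
  (D.card : ℝ)⁻¹ * ∑ d ∈ D, ∑ x, ∑ y, if Φ x y ≠ d then jointProb P W d x y else 0

/-- `-(1/n) log₂ P_e(Φ)`. -/
def finiteExponent {r n : ℕ} [NeZero n] (P : Fin r → ℝ) (W : Fin r → Fin r → ℝ)
    (D : Finset (ZMod n)) (Φ : (ZMod n → Fin r) → (ZMod n → Fin r) → ZMod n) : ℝ :=
  -(1 / (n : ℝ)) * Real.logb 2 (errorProb P W D Φ)

/-- `E` is the (optimal) error exponent for the source `P` and the channel `W`: it is the limit of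
`-(1/n) log₂ P_e(Φ_ML)` along every sequence of delay estimation problems whose length `n` tends
to infinity and whose number of permutation cycles is `o(n / log n)`. -/
def IsErrorExponent {r : ℕ} (P : Fin r → ℝ) (W : Fin r → Fin r → ℝ) (E : ℝ) : Prop :=
  ∀ (n : ℕ → ℕ) [∀ k, NeZero (n k)] (D : ∀ k, Finset (ZMod (n k)))
    (Φ : ∀ k, (ZMod (n k) → Fin r) → (ZMod (n k) → Fin r) → ZMod (n k)),
    Tendsto n atTop atTop →
    (∀ k, IsDelaySet (D k)) →
    (fun k => (maxRelCycles (D k) : ℝ)) =o[atTop] (fun k => (n k : ℝ) / Real.log (n k)) →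
    (∀ k, IsMLDecoder W (D k) (Φ k)) →
    Tendsto (fun k => finiteExponent P W (D k) (Φ k)) atTop (𝓝 E)

end

/-!
For letters let `w a b = √(P a * W a b)`, and let `l` be the largest eigenvalue of `w * wᵀ`, the
matrix of the Bhattacharyya coefficients of pairs of input letters, weighted by `P`. The exponent
is `-log₂ l`.

The square root of the joint probability of `(x, y)` given the delay `d` is the product of the
weights `w (x (i + d)) (y i)`. So the Bhattacharyya coefficient of two delays with difference `d`
is a sum over words of a product over the cycles of the shift by `d`; each cycle is a closed path,
and the sum is `tr ((w * wᵀ) ^ L) ^ k`, where the shift has `k` cycles of length `L`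
(`sum_prod_translate`, `sum_wordWeight_mul`). As `w * wᵀ` is positive semidefinite, this lies
between `l ^ n` and `r ^ k * l ^ n`. The union bound over pairs of delays (`errorProb_le`) then
gives one half of the limit.

For the other half, the error probability of any decoder is at least half of the least of the sums
`∑ min(p₀, p_d)` over the non-identity delays `d`, where `p_d` is the joint law given `d`
(`le_two_mul_errorProb`). Call `(x, y)` balanced if the pairs `(x i, y i)` and the pairs
`(x (i + d), y i)` are the same up to order. Then `p₀ = p_d` at `(x, y)`, and both are equal to
their geometric mean, so it is enough that balanced pairs carry a good part of the Bhattacharyya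
coefficient. Multiply `w a b` by a phase, an `(n + 1)`-th root of unity that depends on `(a, b)`:
the Bhattacharyya sum becomes a power of the trace of a power of a positive semidefinite matrix
`A * Aᴴ`, so it stays nonnegative, and summing over all `(n + 1) ^ (r ^ 2)` choices of phases leaves
exactly the balanced pairs. The `(n + 1) ^ r` choices that depend only on `a` change nothing, and
so the balanced part is at least `(n + 1) ^ (r - r ^ 2)` times the whole, which is at least `l ^ n`
(`trace_pow_le_sum_isBalanced`). This loss is polynomial in `n`, and smaller than the loss allowed
in the bound for finite `n` (`one_add_logb_le`).
-/

/-! ### Closed paths and traces -/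

/-- The sum over all paths of `m` steps of the product of the weights of the steps, with a further
factor that depends on the two endpoints. -/
theorem sum_prod_path {R α : Type*} [CommSemiring R] [Fintype α] [DecidableEq α]
    (B : Matrix α α R) (m : ℕ) (g : α → α → R) :
    ∑ x : Fin (m + 1) → α, (∏ i : Fin m, B (x i.castSucc) (x i.succ)) * g (x 0) (x (Fin.last m))
      = ∑ a, ∑ b, (B ^ m) a b * g a b := by
  induction m generalizing g with
  | zero =>
    rw [← (Equiv.funUnique (Fin 1) α).symm.sum_comp]
    simp [Matrix.one_apply]
  | succ m ih =>
    rw [← (Fin.consEquiv fun _ : Fin (m + 2) => α).sum_comp, Fintype.sum_prod_type]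
    have key : ∀ a : α, ∑ x : Fin (m + 1) → α,
        (∏ i : Fin (m + 1), B ((Fin.cons a x : Fin (m + 2) → α) i.castSucc)
          ((Fin.cons a x : Fin (m + 2) → α) i.succ))
          * g ((Fin.cons a x : Fin (m + 2) → α) 0)
            ((Fin.cons a x : Fin (m + 2) → α) (Fin.last (m + 1)))
        = ∑ a', ∑ b, (B ^ m) a' b * (B a a' * g a b) := by
      intro a
      rw [← ih fun a' b => B a a' * g a b]
      refine Finset.sum_congr rfl fun x _ => ?_
      rw [Fin.prod_univ_succ]
      simp only [Fin.castSucc_zero, Fin.cons_zero, Fin.cons_succ, ← Fin.succ_last,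
        ← Fin.succ_castSucc]
      ring
    refine Finset.sum_congr rfl fun a _ => ?_
    refine (key a).trans ?_
    rw [Finset.sum_comm]
    refine Finset.sum_congr rfl fun b _ => ?_
    rw [pow_succ', Matrix.mul_apply, Finset.sum_mul]
    exact Finset.sum_congr rfl fun a' _ => by ring

theorem sum_prod_closed_path {R α : Type*} [CommSemiring R] [Fintype α] [DecidableEq α]
    (B : Matrix α α R) (m : ℕ) :
    ∑ x : Fin (m + 1) → α, ∏ i, B (x i) (x (i + 1)) = (B ^ (m + 1)).trace := by
  have h := sum_prod_path B m fun a b => B b a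
  simp only [pow_succ, Matrix.trace, Matrix.diag, Matrix.mul_apply]
  rw [← h]
  refine Finset.sum_congr rfl fun x _ => ?_
  rw [Fin.prod_univ_castSucc]
  simp [Fin.coeSucc_eq_succ]

/-- A finite group is the disjoint union of the cycles of the translation by `d`. -/
theorem exists_equiv_cycles {G : Type*} [AddCommGroup G] [Finite G] (d : G) :
    ∃ (m : ℕ) (e : (G ⧸ AddSubgroup.zmultiples d) × Fin (m + 1) ≃ G),
      m + 1 = addOrderOf d ∧ ∀ q k, e (q, k + 1) = e (q, k) + d := by
  classical
  obtain ⟨m, hm⟩ : ∃ m, addOrderOf d = m + 1 :=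
    ⟨addOrderOf d - 1, by have := addOrderOf_pos d; omega⟩
  have hinj : Function.Injective fun p : (G ⧸ AddSubgroup.zmultiples d) × Fin (m + 1) =>
      Quotient.out p.1 + (p.2 : ℕ) • d := by
    rintro ⟨q, k⟩ ⟨q', k'⟩ h
    have hz : ∀ (q : G ⧸ AddSubgroup.zmultiples d) (k : ℕ),
        ((Quotient.out q + k • d : G) : G ⧸ AddSubgroup.zmultiples d) = q := by
      intro q k
      rw [QuotientAddGroup.mk_add_of_mem _ (AddSubgroup.nsmul_mem_zmultiples d k)]
      exact Quotient.out_eq' q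
    have hq : q = q' := by
      rw [← hz q k, ← hz q' k']
      exact congrArg _ h
    subst hq
    have h' : (k : ℕ) • d = (k' : ℕ) • d := add_left_cancel h
    rw [nsmul_inj_mod, hm, Nat.mod_eq_of_lt k.2, Nat.mod_eq_of_lt k'.2] at h'
    rw [Fin.ext h']
  have hsurj : Function.Surjective fun p : (G ⧸ AddSubgroup.zmultiples d) × Fin (m + 1) =>
      Quotient.out p.1 + (p.2 : ℕ) • d := by
    intro g
    have hmem : -Quotient.out (g : G ⧸ AddSubgroup.zmultiples d) + g
        ∈ AddSubgroup.zmultiples d := by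
      rw [← QuotientAddGroup.eq]
      exact Quotient.out_eq' _
    rw [← mem_multiples_iff_mem_zmultiples, mem_multiples_iff_mem_range_addOrderOf] at hmem
    simp only [Finset.mem_image, Finset.mem_range] at hmem
    obtain ⟨k, hk, hkd⟩ := hmem
    refine ⟨((g : G ⧸ AddSubgroup.zmultiples d), ⟨k, hm ▸ hk⟩), ?_⟩
    simp only [hkd]
    abel
  refine ⟨m, Equiv.ofBijective _ ⟨hinj, hsurj⟩, hm.symm, fun q k => ?_⟩
  change Quotient.out q + ((k + 1 : Fin (m + 1)) : ℕ) • d = Quotient.out q + (k : ℕ) • d + d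
  rw [Fin.val_add_one]
  split_ifs with hk
  · have h0 : (m + 1) • d = 0 := by rw [← hm]; exact addOrderOf_nsmul_eq_zero d
    rw [hk, Fin.val_last, add_assoc, ← succ_nsmul, h0, zero_nsmul]
  · rw [succ_nsmul, add_assoc]

/-- The words indexed by a finite group fall apart into closed paths along the cycles of the
translation by `d`. -/
theorem sum_prod_translate {R α G : Type*} [CommSemiring R] [Fintype α] [DecidableEq α]
    [AddCommGroup G] [Fintype G] [DecidableEq G] (B : Matrix α α R) (d : G) :
    ∑ x : G → α, ∏ i, B (x i) (x (i + d))
      = (B ^ addOrderOf d).trace ^ Nat.card (G ⧸ AddSubgroup.zmultiples d) := by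
  classical
  obtain ⟨m, e, hm, he⟩ := exists_equiv_cycles d
  have : Fintype (G ⧸ AddSubgroup.zmultiples d) := Fintype.ofFinite _
  rw [← hm, ← sum_prod_closed_path, Nat.card_eq_fintype_card, ← Finset.card_univ,
    ← Finset.prod_const, Finset.prod_univ_sum, Fintype.piFinset_univ,
    ← ((Equiv.curry _ _ α).symm.trans (Equiv.arrowCongr e (Equiv.refl α))).sum_comp]
  refine Finset.sum_congr rfl fun x _ => ?_
  rw [← e.prod_comp, Fintype.prod_prod_type]
  refine Finset.prod_congr rfl fun q _ => Finset.prod_congr rfl fun k _ => ?_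
  rw [← he]
  simp [Equiv.arrowCongr]

theorem sum_sum_prod_translate {R α β G : Type*} [CommSemiring R] [Fintype α] [DecidableEq α]
    [Fintype β] [DecidableEq β] [AddCommGroup G] [Fintype G] [DecidableEq G]
    (U : Matrix α β R) (V : Matrix β α R) (d : G) :
    ∑ x : G → α, ∑ y : G → β, ∏ i, (U (x i) (y i) * V (y i) (x (i + d)))
      = ((U * V) ^ addOrderOf d).trace ^ Nat.card (G ⧸ AddSubgroup.zmultiples d) := by
  rw [← sum_prod_translate]
  refine Finset.sum_congr rfl fun x _ => ?_
  simp only [Matrix.mul_apply]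
  rw [Finset.prod_univ_sum, Fintype.piFinset_univ]

/-! ### Traces of powers of a positive semidefinite matrix -/

theorem Matrix.IsHermitian.trace_pow_eq_sum_eigenvalues {α : Type*} [Fintype α] [DecidableEq α]
    {M : Matrix α α ℝ} (hM : M.IsHermitian) (L : ℕ) :
    (M ^ L).trace = ∑ i, hM.eigenvalues i ^ L := by
  conv_lhs => rw [hM.spectral_theorem, ← map_pow, Unitary.conjStarAlgAut_apply,
    Matrix.trace_mul_cycle, Unitary.coe_star_mul_self, one_mul,
    Matrix.diagonal_pow]
  simp [Matrix.trace_diagonal]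

/-- The number `l` is the largest eigenvalue of `M`. -/
theorem Matrix.PosSemidef.exists_trace_pow_bounds {α : Type*} [Fintype α] [DecidableEq α]
    {M : Matrix α α ℝ} (hM : M.PosSemidef) (htr : 0 < M.trace) :
    ∃ l : ℝ, 0 < l ∧ ∀ L : ℕ, l ^ L ≤ (M ^ L).trace ∧ (M ^ L).trace ≤ Fintype.card α * l ^ L := by
  have hne : Nonempty α := by
    by_contra h
    rw [not_nonempty_iff] at h
    simp [Matrix.trace] at htr
  obtain ⟨j, hj⟩ := Finite.exists_max hM.1.eigenvalues
  have h0 := hM.eigenvalues_nonneg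
  refine ⟨hM.1.eigenvalues j, ?_, fun L => ?_⟩
  · refine lt_of_le_of_ne (h0 j) fun h => htr.ne' ?_
    rw [← pow_one M, hM.1.trace_pow_eq_sum_eigenvalues]
    exact Finset.sum_eq_zero fun i _ => by
      rw [pow_one]; exact le_antisymm ((hj i).trans h.ge) (h0 i)
  · rw [hM.1.trace_pow_eq_sum_eigenvalues]
    refine ⟨Finset.single_le_sum (f := fun i => hM.1.eigenvalues i ^ L)
      (fun i _ => pow_nonneg (h0 i) L) (Finset.mem_univ j), ?_⟩
    calc ∑ i, hM.1.eigenvalues i ^ L ≤ ∑ _i : α, hM.1.eigenvalues j ^ L :=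
          Finset.sum_le_sum fun i _ => pow_le_pow_left₀ (h0 i) (hj i) L
      _ = _ := by simp

/-! ### Balanced pairs of words -/

/-- The pair of words `(x, y)` is balanced for the translation by `d` if every pair of letters
occurs as often among the pairs `(x i, y i)` as among the pairs `(x (i + d), y i)`. -/
def IsBalanced {G α β : Type*} [AddCommGroup G] [Fintype G] (d : G) (x : G → α) (y : G → β) :
    Prop :=
  (Finset.univ : Finset G).val.map (fun i => (x i, y i))
    = (Finset.univ : Finset G).val.map (fun i => (x (i + d), y i))

theorem IsBalanced.prod_eq {G α β R : Type*} [AddCommGroup G] [Fintype G] [CommMonoid R] {d : G}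
    {x : G → α} {y : G → β} (h : IsBalanced d x y) (f : α → β → R) :
    ∏ i, f (x i) (y i) = ∏ i, f (x (i + d)) (y i) := by
  have := congrArg (fun s => (Multiset.map (fun p : α × β => f p.1 p.2) s).prod) h
  simp only [Multiset.map_map] at this
  exact this

/-- Balance can be tested modulo any number greater than the length of the words, since the
multiplicities do not exceed the length. -/
theorem isBalanced_iff_forall_sum {G α β : Type*} [AddCommGroup G] [Fintype G]
    {m : ℕ} (hm : Fintype.card G < m) (d : G) (x : G → α) (y : G → β) :
    IsBalanced d x y ↔
      ∀ t : α × β → ZMod m, ∑ i, (t (x i, y i) - t (x (i + d), y i)) = 0 := by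
  classical
  constructor
  · intro h t
    have := congrArg (fun s => (Multiset.map t s).sum) h
    rw [Finset.sum_sub_distrib, sub_eq_zero]
    simp only [Multiset.map_map] at this
    exact this
  · intro h
    refine Multiset.ext.2 fun p => ?_
    have h1 := h (Pi.single p 1)
    rw [Finset.sum_sub_distrib, sub_eq_zero] at h1
    simp only [Pi.single_apply, Finset.sum_boole] at h1
    rw [ZMod.natCast_eq_natCast_iff', Nat.mod_eq_of_lt, Nat.mod_eq_of_lt] at h1
    · simp only [Multiset.count_map, eq_comm (a := p)]
      exact h1
    · exact (Finset.card_le_univ _).trans_lt hm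
    · exact (Finset.card_le_univ _).trans_lt hm

/-- The character of the group of phases `t : α × β → ZMod m` that belongs to a pair of words. -/
noncomputable def phaseChar {G α β : Type*} [AddCommGroup G] [Fintype G] (m : ℕ) [NeZero m]
    (d : G) (x : G → α) (y : G → β) : AddChar (α × β → ZMod m) ℂ where
  toFun t := ZMod.stdAddChar (∑ i, (t (x i, y i) - t (x (i + d), y i)))
  map_zero_eq_one' := by simp
  map_add_eq_mul' s t := by
    rw [← AddChar.map_add_eq_mul, ← Finset.sum_add_distrib]
    congr 1
    exact Finset.sum_congr rfl fun i _ => by simp only [Pi.add_apply]; ring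

theorem phaseChar_apply {G α β : Type*} [AddCommGroup G] [Fintype G] (m : ℕ) [NeZero m]
    (d : G) (x : G → α) (y : G → β) (t : α × β → ZMod m) :
    phaseChar m d x y t = ZMod.stdAddChar (∑ i, (t (x i, y i) - t (x (i + d), y i))) := rfl

theorem phaseChar_eq_zero_iff {G α β : Type*} [AddCommGroup G] [Fintype G]
    {m : ℕ} [NeZero m] (hm : Fintype.card G < m) (d : G) (x : G → α) (y : G → β) :
    phaseChar m d x y = 0 ↔ IsBalanced d x y := by
  rw [isBalanced_iff_forall_sum hm, DFunLike.ext_iff]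
  refine forall_congr' fun t => ?_
  rw [phaseChar_apply, AddChar.zero_apply, ← AddChar.map_zero_eq_one (ZMod.stdAddChar (N := m))]
  exact ZMod.injective_stdAddChar.eq_iff

open scoped Classical in
theorem sum_phaseChar {G α β : Type*} [AddCommGroup G] [Fintype G] [Fintype α] [DecidableEq α]
    [Fintype β] [DecidableEq β] {m : ℕ} [NeZero m] (hm : Fintype.card G < m) (d : G)
    (x : G → α) (y : G → β) :
    ∑ t, phaseChar m d x y t
      = if IsBalanced d x y then (m : ℂ) ^ (Fintype.card α * Fintype.card β) else 0 := by
  rw [AddChar.sum_eq_ite]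
  simp only [phaseChar_eq_zero_iff hm]
  simp

/-- A phase that depends only on the first letter has no effect: its values telescope along every
cycle. -/
theorem phaseChar_fst {G α β : Type*} [AddCommGroup G] [Fintype G] (m : ℕ) [NeZero m]
    (d : G) (x : G → α) (y : G → β) (f : α → ZMod m) :
    phaseChar m d x y (fun p => f p.1) = 1 := by
  have h : ∑ i, f (x (i + d)) = ∑ i, f (x i) :=
    Fintype.sum_equiv (Equiv.addRight d) _ _ fun _ => rfl
  rw [phaseChar_apply, Finset.sum_sub_distrib]
  simp only [h, sub_self, AddChar.map_zero_eq_one]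

open scoped ComplexOrder Matrix in
/-- A sum over words twisted by a phase is a power of the trace of a power of `A * Aᴴ`, hence
nonnegative. -/
theorem sum_mul_phaseChar_nonneg {G α β : Type*} [AddCommGroup G] [Fintype G] [DecidableEq G]
    [Fintype α] [DecidableEq α] [Fintype β] [DecidableEq β] (m : ℕ) [NeZero m] (w : Matrix α β ℝ)
    (d : G) (t : α × β → ZMod m) :
    0 ≤ ∑ x : G → α, ∑ y : G → β,
      ((∏ i, (w (x i) (y i) * w (x (i + d)) (y i)) : ℝ) : ℂ) * phaseChar m d x y t := by
  let A : Matrix α β ℂ := Matrix.of fun a b => (w a b : ℂ) * ZMod.stdAddChar (t (a, b))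
  have h := sum_sum_prod_translate A Aᴴ d
  have h0 : 0 ≤ ((A * Aᴴ) ^ addOrderOf d).trace ^ Nat.card (G ⧸ AddSubgroup.zmultiples d) :=
    pow_nonneg ((Matrix.posSemidef_self_mul_conjTranspose A).pow _).trace_nonneg _
  rw [← h] at h0
  refine h0.trans_eq (Finset.sum_congr rfl fun x _ => Finset.sum_congr rfl fun y _ => ?_)
  have hs : phaseChar m d x y t
      = ∏ i, ZMod.stdAddChar (t (x i, y i) - t (x (i + d), y i)) :=
    map_prod (ZMod.stdAddChar (N := m)).toMonoidHom
      (fun i => Multiplicative.ofAdd (t (x i, y i) - t (x (i + d), y i))) Finset.univ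
  rw [hs]
  push_cast
  rw [← Finset.prod_mul_distrib]
  refine Finset.prod_congr rfl fun i _ => ?_
  rw [sub_eq_add_neg, AddChar.map_add_eq_mul, AddChar.map_neg_eq_conj]
  simp only [A, Matrix.of_apply, Matrix.conjTranspose_apply, star_mul', Complex.star_def,
    Complex.conj_ofReal]
  ring

open scoped ComplexOrder Matrix Classical in
/-- The balanced pairs of words carry at least a polynomial fraction of the total weight. The sum
over all phases picks out the balanced pairs, every phase contributes a nonnegative amount, and the
`m ^ card α` phases that depend only on the first letter contribute the total weight each. -/
theorem trace_pow_le_sum_isBalanced {G α β : Type*} [AddCommGroup G] [Fintype G] [DecidableEq G]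
    [Fintype α] [DecidableEq α] [Fintype β] [DecidableEq β] [Nonempty β] {m : ℕ}
    (hm : Fintype.card G < m) (w : Matrix α β ℝ) (d : G) :
    (m : ℝ) ^ Fintype.card α *
        ((w * wᵀ) ^ addOrderOf d).trace ^ Nat.card (G ⧸ AddSubgroup.zmultiples d)
      ≤ (m : ℝ) ^ (Fintype.card α * Fintype.card β) *
        ∑ x : G → α, ∑ y : G → β,
          if IsBalanced d x y then ∏ i, (w (x i) (y i) * w (x (i + d)) (y i)) else 0 := by
  have : NeZero m := ⟨by omega⟩
  set Z : (α × β → ZMod m) → ℂ := fun t => ∑ x : G → α, ∑ y : G → β,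
    ((∏ i, (w (x i) (y i) * w (x (i + d)) (y i)) : ℝ) : ℂ) * phaseChar m d x y t with hZ
  have hall : ∑ t, Z t = ((m : ℝ) ^ (Fintype.card α * Fintype.card β) *
        ∑ x : G → α, ∑ y : G → β,
          if IsBalanced d x y then ∏ i, (w (x i) (y i) * w (x (i + d)) (y i)) else 0 : ℝ) := by
    simp only [hZ]
    rw [Finset.sum_comm, Finset.mul_sum, Complex.ofReal_sum]
    refine Finset.sum_congr rfl fun x _ => ?_
    rw [Finset.sum_comm, Finset.mul_sum, Complex.ofReal_sum]
    refine Finset.sum_congr rfl fun y _ => ?_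
    rw [← Finset.mul_sum, sum_phaseChar hm]
    split_ifs
    · push_cast; ring
    · simp
  have hrow : ∀ f : α → ZMod m, Z (fun p => f p.1)
      = (((w * wᵀ) ^ addOrderOf d).trace ^ Nat.card (G ⧸ AddSubgroup.zmultiples d) : ℝ) := by
    intro f
    simp only [hZ, phaseChar_fst, mul_one]
    rw [← sum_sum_prod_translate]
    push_cast
    rfl
  have hinj : Function.Injective fun (f : α → ZMod m) (p : α × β) => f p.1 := by
    intro f g h
    funext a
    exact congrFun h (a, Classical.arbitrary β)
  have hle : ∑ f : α → ZMod m, Z (fun p => f p.1) ≤ ∑ t, Z t := by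
    rw [← Finset.sum_image (f := Z) (g := fun (f : α → ZMod m) (p : α × β) => f p.1)
      fun f _ g _ h => hinj h]
    exact Finset.sum_le_sum_of_subset_of_nonneg (Finset.subset_univ _)
      fun t _ _ => sum_mul_phaseChar_nonneg m w d t
  rw [hall] at hle
  simp only [hrow, Finset.sum_const, Finset.card_univ, Fintype.card_fun, ZMod.card,
    nsmul_eq_mul] at hle
  rw [← Complex.real_le_real]
  refine le_trans (le_of_eq ?_) hle
  push_cast
  rfl

/-! ### Cyclic shifts and their cycles -/

theorem cyclicShift_inv_mul {n : ℕ} (d e : ZMod n) :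
    (cyclicShift e)⁻¹ * cyclicShift d = cyclicShift (d - e) := by
  rw [inv_mul_eq_iff_eq_mul]
  ext i
  simp only [cyclicShift, Equiv.Perm.mul_apply, Equiv.coe_addRight]
  abel

theorem cyclicShift_zpow {n : ℕ} (d : ZMod n) (k : ℤ) :
    cyclicShift d ^ k = cyclicShift (k • d) := by
  have hadd : ∀ a b : ZMod n, cyclicShift (a + b) = cyclicShift a * cyclicShift b := fun a b => by
    ext i
    simp only [cyclicShift, Equiv.Perm.mul_apply, Equiv.coe_addRight]
    abel
  let f : Multiplicative (ZMod n) →* Equiv.Perm (ZMod n) :=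
    MonoidHom.mk' (fun a => cyclicShift a.toAdd) fun a b => hadd a.toAdd b.toAdd
  exact (map_zpow f (Multiplicative.ofAdd d) k).symm

theorem numCycles_cyclicShift {n : ℕ} (d : ZMod n) :
    numCycles (cyclicShift d) = Nat.card (ZMod n ⧸ AddSubgroup.zmultiples d) := by
  refine Nat.card_congr (Quotient.congr (Equiv.refl _) fun a b => ?_)
  change (cyclicShift d).SameCycle a b ↔ QuotientAddGroup.leftRel _ a b
  rw [QuotientAddGroup.leftRel_apply, AddSubgroup.mem_zmultiples_iff]
  refine exists_congr fun k => ?_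
  rw [cyclicShift_zpow, cyclicShift, Equiv.coe_addRight, neg_add_eq_sub, eq_sub_iff_add_eq,
    add_comm]

theorem numCycles_mul_addOrderOf {n : ℕ} (d : ZMod n) :
    numCycles (cyclicShift d) * addOrderOf d = n := by
  rw [numCycles_cyclicShift, ← Nat.card_zmultiples,
    ← AddSubgroup.card_eq_card_quotient_mul_card_addSubgroup, Nat.card_zmod]

theorem two_mul_numCycles_le {n : ℕ} [NeZero n] {d : ZMod n} (hd : d ≠ 0) :
    2 * numCycles (cyclicShift d) ≤ n := by
  have h1 : addOrderOf d ≠ 1 := by rwa [Ne, AddMonoid.addOrderOf_eq_one_iff]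
  have h2 := addOrderOf_pos d
  calc 2 * numCycles (cyclicShift d) ≤ addOrderOf d * numCycles (cyclicShift d) := by
        gcongr; omega
    _ = n := by rw [mul_comm, numCycles_mul_addOrderOf]

theorem exists_numCycles_eq_maxCycles {n : ℕ} {D : Finset (ZMod n)} (hD : IsDelaySet D) :
    ∃ d ∈ D, d ≠ 0 ∧ numCycles (cyclicShift d) = maxCycles D := by
  obtain ⟨e, he, he0⟩ := hD.2
  obtain ⟨d, hd, h⟩ := Finset.exists_mem_eq_sup (D.erase 0) ⟨e, Finset.mem_erase.2 ⟨he0, he⟩⟩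
    fun d => numCycles (cyclicShift d)
  rw [Finset.mem_erase] at hd
  exact ⟨d, hd.2, hd.1, h.symm⟩

theorem numCycles_sub_le_maxRelCycles {n : ℕ} {D : Finset (ZMod n)} {d e : ZMod n} (hd : d ∈ D)
    (he : e ∈ D) (h : d ≠ e) : numCycles (cyclicShift (d - e)) ≤ maxRelCycles D := by
  rw [← cyclicShift_inv_mul]
  have hmem : (d, e) ∈ D.offDiag := Finset.mem_offDiag.2 ⟨hd, he, h⟩
  generalize hf : (fun p : ZMod n × ZMod n =>
    numCycles ((cyclicShift p.2)⁻¹ * cyclicShift p.1)) = f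
  rw [maxRelCycles, hf]
  exact (congrFun hf (d, e)).trans_le (Finset.le_sup hmem)

/-! ### Half-likelihoods -/

/-- The matrix of the square roots of the joint probabilities of an input and an output letter. -/
noncomputable def sqrtJoint {r : ℕ} (P : Fin r → ℝ) (W : Fin r → Fin r → ℝ) :
    Matrix (Fin r) (Fin r) ℝ :=
  Matrix.of fun a b => √(P a * W a b)

/-- The square root of the joint probability of `(x, y)` given the delay `d`. -/
noncomputable def wordWeight {r n : ℕ} [NeZero n] (P : Fin r → ℝ) (W : Fin r → Fin r → ℝ)
    (d : ZMod n) (x y : ZMod n → Fin r) : ℝ :=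
  ∏ i, sqrtJoint P W (x (i + d)) (y i)

theorem wordWeight_nonneg {r n : ℕ} [NeZero n] (P : Fin r → ℝ) (W : Fin r → Fin r → ℝ)
    (d : ZMod n) (x y : ZMod n → Fin r) : 0 ≤ wordWeight P W d x y :=
  Finset.prod_nonneg fun _ _ => Real.sqrt_nonneg _

theorem jointProb_eq_prod {r n : ℕ} [NeZero n] (P : Fin r → ℝ) (W : Fin r → Fin r → ℝ)
    (d : ZMod n) (x y : ZMod n → Fin r) :
    jointProb P W d x y = ∏ i, (P (x (i + d)) * W (x (i + d)) (y i)) := by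
  have h : ∏ i, P (x (i + d)) = ∏ i, P (x i) :=
    Fintype.prod_equiv (Equiv.addRight d) _ _ fun _ => rfl
  rw [Finset.prod_mul_distrib, h]
  rfl

theorem jointProb_eq_sq {r n : ℕ} [NeZero n] {P : Fin r → ℝ} (hP : ∀ a, 0 ≤ P a)
    {W : Fin r → Fin r → ℝ} (hW : ∀ a b, 0 ≤ W a b) (d : ZMod n) (x y : ZMod n → Fin r) :
    jointProb P W d x y = wordWeight P W d x y ^ 2 := by
  rw [jointProb_eq_prod, wordWeight, ← Finset.prod_pow]
  exact Finset.prod_congr rfl fun i _ => (Real.sq_sqrt (mul_nonneg (hP _) (hW _ _))).symm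

open scoped Matrix in
/-- The Bhattacharyya coefficient of the joint laws given two delays depends only on the cycle
type of their difference. -/
theorem sum_wordWeight_mul {r n : ℕ} [NeZero n] (P : Fin r → ℝ) (W : Fin r → Fin r → ℝ)
    (d e : ZMod n) :
    ∑ x : ZMod n → Fin r, ∑ y : ZMod n → Fin r, wordWeight P W e x y * wordWeight P W d x y
      = ((sqrtJoint P W * (sqrtJoint P W)ᵀ) ^ addOrderOf (d - e)).trace
        ^ numCycles (cyclicShift (d - e)) := by
  rw [numCycles_cyclicShift, ← sum_sum_prod_translate]
  refine Fintype.sum_equiv (Equiv.arrowCongr (Equiv.addRight (-e)) (Equiv.refl _)) _ _ fun x => ?_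
  refine Finset.sum_congr rfl fun y _ => ?_
  rw [wordWeight, wordWeight, ← Finset.prod_mul_distrib]
  refine Finset.prod_congr rfl fun i _ => ?_
  simp [Equiv.arrowCongr, add_assoc]

open scoped Matrix in
/-- The base `l` of the exponent: the largest eigenvalue of the matrix of the Bhattacharyya
coefficients of pairs of letters. -/
theorem exists_base {r : ℕ} {P : Fin r → ℝ} (hP : P ∈ stdSimplex ℝ (Fin r))
    {W : Fin r → Fin r → ℝ} (hW : ∀ a, W a ∈ stdSimplex ℝ (Fin r)) :
    ∃ l : ℝ, 0 < l ∧ ∀ (n : ℕ) (d : ZMod n),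
      l ^ n ≤ ((sqrtJoint P W * (sqrtJoint P W)ᵀ) ^ addOrderOf d).trace
        ^ numCycles (cyclicShift d) ∧
      ((sqrtJoint P W * (sqrtJoint P W)ᵀ) ^ addOrderOf d).trace ^ numCycles (cyclicShift d)
        ≤ (r : ℝ) ^ numCycles (cyclicShift d) * l ^ n := by
  have hpsd : (sqrtJoint P W * (sqrtJoint P W)ᵀ).PosSemidef := by
    rw [← Matrix.conjTranspose_eq_transpose_of_trivial]
    exact Matrix.posSemidef_self_mul_conjTranspose _
  have htr : (sqrtJoint P W * (sqrtJoint P W)ᵀ).trace = 1 := by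
    have h : ∀ a b, sqrtJoint P W a b * sqrtJoint P W a b = P a * W a b := fun a b =>
      Real.mul_self_sqrt (mul_nonneg (hP.1 a) ((hW a).1 b))
    simp only [Matrix.trace, Matrix.diag, Matrix.mul_apply, Matrix.transpose_apply, h,
      ← Finset.mul_sum, (hW _).2, mul_one, hP.2]
  obtain ⟨l, hl, hb⟩ := hpsd.exists_trace_pow_bounds (htr ▸ one_pos)
  refine ⟨l, hl, fun n d => ?_⟩
  obtain ⟨h1, h2⟩ := hb (addOrderOf d)
  have hn : l ^ n = (l ^ addOrderOf d) ^ numCycles (cyclicShift d) := by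
    rw [← pow_mul, mul_comm, numCycles_mul_addOrderOf]
  rw [hn]
  refine ⟨pow_le_pow_left₀ (by positivity) h1 _, ?_⟩
  rw [← mul_pow]
  rw [Fintype.card_fin] at h2
  exact pow_le_pow_left₀ ((by positivity : 0 ≤ l ^ addOrderOf d).trans h1) h2 _

/-! ### Bounds for the error probability -/

/-- The Bhattacharyya bound: where the decoder prefers `e` to the true delay `d`, the joint
probability given `d` is at most the geometric mean of those given `d` and `e`. -/
theorem errorProb_le {r n : ℕ} [NeZero n] {P : Fin r → ℝ} (hP : ∀ a, 0 ≤ P a)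
    {W : Fin r → Fin r → ℝ} (hW : ∀ a b, 0 ≤ W a b) {D : Finset (ZMod n)} {c : ℝ} (hc : 0 ≤ c)
    (h : ∀ d ∈ D, ∀ e ∈ D, d ≠ e → ∑ x : ZMod n → Fin r, ∑ y : ZMod n → Fin r,
      wordWeight P W e x y * wordWeight P W d x y ≤ c)
    {Φ : (ZMod n → Fin r) → (ZMod n → Fin r) → ZMod n} (hΦ : IsMLDecoder W D Φ) :
    errorProb P W D Φ ≤ n * c := by
  have key : ∀ d ∈ D, ∑ x, ∑ y, (if Φ x y ≠ d then jointProb P W d x y else 0) ≤ n * c := by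
    intro d hd
    calc ∑ x, ∑ y, (if Φ x y ≠ d then jointProb P W d x y else 0)
        ≤ ∑ x, ∑ y, ∑ e ∈ D.erase d, wordWeight P W e x y * wordWeight P W d x y := by
          refine Finset.sum_le_sum fun x _ => Finset.sum_le_sum fun y _ => ?_
          have h0 : ∀ e ∈ D.erase d, 0 ≤ wordWeight P W e x y * wordWeight P W d x y :=
            fun e _ => mul_nonneg (wordWeight_nonneg ..) (wordWeight_nonneg ..)
          split_ifs with hne
          · refine le_trans ?_ (Finset.single_le_sum h0
              (Finset.mem_erase.2 ⟨hne, (hΦ x y).1⟩))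
            have hle : wordWeight P W d x y ^ 2 ≤ wordWeight P W (Φ x y) x y ^ 2 := by
              rw [← jointProb_eq_sq hP hW, ← jointProb_eq_sq hP hW]
              exact mul_le_mul_of_nonneg_left ((hΦ x y).2 d hd)
                (Finset.prod_nonneg fun _ _ => hP _)
            rw [jointProb_eq_sq hP hW, sq]
            exact mul_le_mul_of_nonneg_right
              ((sq_le_sq₀ (wordWeight_nonneg ..) (wordWeight_nonneg ..)).1 hle)
              (wordWeight_nonneg ..)
          · exact Finset.sum_nonneg h0
      _ = ∑ e ∈ D.erase d, ∑ x, ∑ y, wordWeight P W e x y * wordWeight P W d x y := by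
          rw [Finset.sum_comm (s := D.erase d)]
          exact Finset.sum_congr rfl fun x _ => Finset.sum_comm
      _ ≤ ∑ e ∈ D.erase d, c := Finset.sum_le_sum fun e he =>
          h d hd e (Finset.mem_of_mem_erase he) (Finset.ne_of_mem_erase he).symm
      _ ≤ n * c := by
          rw [Finset.sum_const, nsmul_eq_mul]
          have : (D.erase d).card ≤ n := (Finset.card_le_univ _).trans_eq (ZMod.card n)
          gcongr
  have h1 : ∑ d ∈ D, ∑ x, ∑ y, (if Φ x y ≠ d then jointProb P W d x y else 0)
      ≤ D.card * (n * c) := by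
    rw [← nsmul_eq_mul, ← Finset.sum_const]
    exact Finset.sum_le_sum key
  rw [errorProb, inv_mul_eq_div]
  exact div_le_of_le_mul₀ (by positivity) (by positivity) (by rwa [mul_comm])

/-- Whatever the decoder, it confuses the delays at least half as often as the decision between
the identity and a single other delay would. For each `(x, y)`, all joint probabilities but at most
one contribute to the error; in the star graph that joins `0` to the other delays, each edge can be
charged to a different one of them. -/
theorem le_two_mul_errorProb {r n : ℕ} [NeZero n] {P : Fin r → ℝ} (hP : ∀ a, 0 ≤ P a)
    {W : Fin r → Fin r → ℝ} (hW : ∀ a b, 0 ≤ W a b) {D : Finset (ZMod n)} (hD : IsDelaySet D)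
    {c : ℝ} (h : ∀ d ∈ D, d ≠ 0 →
      c ≤ ∑ x, ∑ y, min (jointProb P W 0 x y) (jointProb P W d x y))
    (hc : 0 ≤ c) (Φ : (ZMod n → Fin r) → (ZMod n → Fin r) → ZMod n) :
    c ≤ 2 * errorProb P W D Φ := by
  have hnn : ∀ d x y, 0 ≤ jointProb P W (n := n) d x y := fun d x y => by
    rw [jointProb_eq_sq hP hW]; positivity
  have hpt : ∀ x y, ∑ d ∈ D.erase 0, min (jointProb P W 0 x y) (jointProb P W d x y)
      ≤ ∑ d ∈ D, if Φ x y ≠ d then jointProb P W d x y else 0 := by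
    intro x y
    rw [← Finset.add_sum_erase D _ hD.1]
    by_cases h0 : Φ x y = 0
    · rw [if_neg (not_not.2 h0), zero_add]
      refine Finset.sum_le_sum fun d hd => ?_
      rw [if_pos (h0 ▸ (Finset.ne_of_mem_erase hd).symm)]
      exact min_le_right _ _
    · rw [if_pos h0]
      by_cases hm : Φ x y ∈ D.erase 0
      · rw [← Finset.add_sum_erase _ _ hm, ← Finset.add_sum_erase (D.erase 0)
          (fun d => if Φ x y ≠ d then jointProb P W d x y else 0) hm,
          if_neg (not_not.2 rfl), zero_add]
        refine add_le_add (min_le_left _ _) (Finset.sum_le_sum fun d hd => ?_)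
        rw [if_pos (Finset.ne_of_mem_erase hd).symm]
        exact min_le_right _ _
      · refine le_add_of_nonneg_of_le (hnn _ _ _) (Finset.sum_le_sum fun d hd => ?_)
        rw [if_pos fun hd' : Φ x y = d => hm (hd' ▸ hd)]
        exact min_le_right _ _
  have hsum : (D.erase 0).card * c
      ≤ ∑ d ∈ D, ∑ x, ∑ y, (if Φ x y ≠ d then jointProb P W d x y else 0) := by
    calc (D.erase 0).card * c
        ≤ ∑ d ∈ D.erase 0, ∑ x, ∑ y, min (jointProb P W 0 x y) (jointProb P W d x y) := by
          rw [← nsmul_eq_mul, ← Finset.sum_const]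
          exact Finset.sum_le_sum fun d hd =>
            h d (Finset.mem_of_mem_erase hd) (Finset.ne_of_mem_erase hd)
      _ = ∑ x, ∑ y, ∑ d ∈ D.erase 0, min (jointProb P W 0 x y) (jointProb P W d x y) := by
          rw [Finset.sum_comm]
          exact Finset.sum_congr rfl fun x _ => Finset.sum_comm
      _ ≤ ∑ x, ∑ y, ∑ d ∈ D, (if Φ x y ≠ d then jointProb P W d x y else 0) :=
          Finset.sum_le_sum fun x _ => Finset.sum_le_sum fun y _ => hpt x y
      _ = _ := by
          rw [Finset.sum_comm (s := D)]
          exact Finset.sum_congr rfl fun x _ => Finset.sum_comm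
  have hcard : D.card = (D.erase 0).card + 1 := (Finset.card_erase_add_one hD.1).symm
  have hpos : 1 ≤ (D.erase 0).card := by
    obtain ⟨e, he, he0⟩ := hD.2
    exact Finset.card_pos.2 ⟨e, Finset.mem_erase.2 ⟨he0, he⟩⟩
  have hDpos : (0 : ℝ) < D.card := by rw [hcard]; positivity
  have hle : (D.card : ℝ) * c ≤ 2 * ((D.erase 0).card * c) := by
    rw [hcard, ← mul_assoc]
    refine mul_le_mul_of_nonneg_right ?_ hc
    have : (1 : ℝ) ≤ (D.erase 0).card := by exact_mod_cast hpos
    push_cast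
    linarith
  rw [errorProb, mul_left_comm, inv_mul_eq_div, le_div_iff₀ hDpos, mul_comm c]
  linarith

open scoped Classical in
/-- On balanced pairs of words the joint laws given the delays `0` and `d` agree. -/
theorem sum_isBalanced_le_sum_min {r n : ℕ} [NeZero n] {P : Fin r → ℝ} (hP : ∀ a, 0 ≤ P a)
    {W : Fin r → Fin r → ℝ} (hW : ∀ a b, 0 ≤ W a b) (d : ZMod n) :
    ∑ x : ZMod n → Fin r, ∑ y : ZMod n → Fin r, (if IsBalanced d x y then
        ∏ i, (sqrtJoint P W (x i) (y i) * sqrtJoint P W (x (i + d)) (y i)) else 0)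
      ≤ ∑ x, ∑ y, min (jointProb P W 0 x y) (jointProb P W d x y) := by
  refine Finset.sum_le_sum fun x _ => Finset.sum_le_sum fun y _ => ?_
  rw [jointProb_eq_sq hP hW, jointProb_eq_sq hP hW]
  split_ifs with hb
  · have h := hb.prod_eq (sqrtJoint P W)
    simp only [wordWeight, add_zero]
    rw [Finset.prod_mul_distrib, h, min_self, sq]
  · positivity

theorem pos_of_mem_stdSimplex {r : ℕ} {P : Fin r → ℝ} (hP : P ∈ stdSimplex ℝ (Fin r)) : 0 < r := by
  rcases Nat.eq_zero_or_pos r with rfl | h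
  · simpa using hP.2
  · exact h

open scoped Matrix in
/-- The converse: a type count over all `n` positions costs no more than a factor polynomial in
`n`, whatever the number of cycles. -/
theorem errorProb_pos_and_neg_logb_le {r n : ℕ} [NeZero n] {P : Fin r → ℝ}
    (hP : P ∈ stdSimplex ℝ (Fin r)) {W : Fin r → Fin r → ℝ}
    (hW : ∀ a, W a ∈ stdSimplex ℝ (Fin r)) {l : ℝ} (hl : 0 < l)
    (hb : ∀ d : ZMod n, l ^ n ≤ ((sqrtJoint P W * (sqrtJoint P W)ᵀ) ^ addOrderOf d).trace
        ^ numCycles (cyclicShift d))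
    {D : Finset (ZMod n)} (hD : IsDelaySet D)
    (Φ : (ZMod n → Fin r) → (ZMod n → Fin r) → ZMod n) :
    0 < errorProb P W D Φ ∧ -Real.logb 2 (errorProb P W D Φ)
      ≤ n * -Real.logb 2 l + 1 + ((r : ℝ) ^ 2 - r) * Real.logb 2 (n + 1) := by
  have : NeZero r := ⟨(pos_of_mem_stdSimplex hP).ne'⟩
  have hm : (0 : ℝ) < n + 1 := by positivity
  have hc : 0 < (n + 1 : ℝ) ^ r * l ^ n / (n + 1 : ℝ) ^ (r * r) := by positivity
  have h := le_two_mul_errorProb hP.1 (fun a => (hW a).1) hD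
    (c := (n + 1 : ℝ) ^ r * l ^ n / (n + 1 : ℝ) ^ (r * r)) (fun d _ _ => by
      refine le_trans ?_ (sum_isBalanced_le_sum_min hP.1 (fun a => (hW a).1) d)
      have ht := trace_pow_le_sum_isBalanced (m := n + 1) (by rw [ZMod.card]; omega)
        (sqrtJoint P W) d
      rw [← numCycles_cyclicShift, Fintype.card_fin] at ht
      push_cast at ht
      rw [div_le_iff₀' (by positivity)]
      exact (mul_le_mul_of_nonneg_left (hb d) (by positivity)).trans ht) hc.le Φ
  have hpos : 0 < errorProb P W D Φ := by linarith
  refine ⟨hpos, ?_⟩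
  have hlog := Real.logb_le_logb_of_le one_lt_two hc h
  rw [Real.logb_div (by positivity) (by positivity), Real.logb_mul (by positivity) (by positivity),
    Real.logb_mul two_ne_zero hpos.ne', Real.logb_pow, Real.logb_pow, Real.logb_pow,
    Real.logb_self_eq_one one_lt_two] at hlog
  push_cast at hlog
  linarith

open scoped Matrix in
theorem logb_errorProb_le {r n : ℕ} [NeZero n] {P : Fin r → ℝ}
    (hP : P ∈ stdSimplex ℝ (Fin r)) {W : Fin r → Fin r → ℝ}
    (hW : ∀ a, W a ∈ stdSimplex ℝ (Fin r)) {l : ℝ} (hl : 0 < l)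
    (hb : ∀ d : ZMod n, ((sqrtJoint P W * (sqrtJoint P W)ᵀ) ^ addOrderOf d).trace
        ^ numCycles (cyclicShift d) ≤ (r : ℝ) ^ numCycles (cyclicShift d) * l ^ n)
    {D : Finset (ZMod n)} {Φ : (ZMod n → Fin r) → (ZMod n → Fin r) → ZMod n}
    (hΦ : IsMLDecoder W D Φ) (hpos : 0 < errorProb P W D Φ) :
    Real.logb 2 (errorProb P W D Φ)
      ≤ Real.logb 2 n + maxRelCycles D * Real.logb 2 r + n * Real.logb 2 l := by
  have hr : 0 < r := pos_of_mem_stdSimplex hP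
  have hr1 : (1 : ℝ) ≤ r := by exact_mod_cast hr
  have hn : (0 : ℝ) < n := by exact_mod_cast NeZero.pos n
  have h := errorProb_le hP.1 (fun a => (hW a).1)
    (c := (r : ℝ) ^ maxRelCycles D * l ^ n) (by positivity) (fun d hd e he hde => by
      rw [sum_wordWeight_mul]
      refine (hb _).trans (mul_le_mul_of_nonneg_right ?_ (by positivity))
      exact pow_le_pow_right₀ hr1 (numCycles_sub_le_maxRelCycles hd he hde)) hΦ
  refine (Real.logb_le_logb_of_le one_lt_two hpos h).trans_eq ?_
  rw [Real.logb_mul (by positivity) (by positivity), Real.logb_mul (by positivity) (by positivity),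
    Real.logb_pow, Real.logb_pow]
  ring

/-! ### The error exponent -/

/-- The loss of a global type count over the `n` positions is at most the loss of a type count on
each of `k` cycles, by Bernoulli's inequality `n + 1 ≤ (1 + n / k) ^ k`; the `r` degrees of freedom
that the former saves pay for the factor `2 * r ^ k`, since `2 * r ≤ 3 ^ r`. -/
theorem one_add_logb_le {r n k : ℕ} (hr : 0 < r) (hk : 0 < k) (hkn : 2 * k ≤ n) :
    1 + ((r : ℝ) ^ 2 - r) * Real.logb 2 (n + 1)
      ≤ k * (r : ℝ) ^ 2 * Real.logb 2 (1 + n / k) - k * Real.logb 2 r := by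
  have hk' : (0 : ℝ) < k := by exact_mod_cast hk
  have hk1 : (1 : ℝ) ≤ k := by exact_mod_cast hk
  have hr' : (0 : ℝ) < r := by exact_mod_cast hr
  have hr1 : (1 : ℝ) ≤ r := by exact_mod_cast hr
  have ht : (2 : ℝ) ≤ n / k := by
    rw [le_div_iff₀ hk']
    exact_mod_cast hkn
  have hbern : Real.logb 2 (n + 1) ≤ k * Real.logb 2 (1 + n / k) := by
    rw [← Real.logb_pow]
    refine Real.logb_le_logb_of_le one_lt_two (by positivity) ?_
    refine le_trans (le_of_eq ?_) (one_add_mul_le_pow (by linarith) k)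
    field_simp
    ring
  have hthree : 1 + Real.logb 2 r ≤ r * Real.logb 2 (1 + n / k) := by
    have h3 : 2 * (r : ℝ) ≤ 3 ^ r := by
      have := one_add_mul_le_pow (by norm_num : (-2 : ℝ) ≤ 2) r
      norm_num at this
      linarith
    have h := Real.logb_le_logb_of_le one_lt_two (by positivity)
      (h3.trans (pow_le_pow_left₀ (by norm_num) (by linarith : (3 : ℝ) ≤ 1 + n / k) r))
    rwa [Real.logb_mul two_ne_zero hr'.ne', Real.logb_self_eq_one one_lt_two, Real.logb_pow] at h
  have h1 := mul_le_mul_of_nonneg_left hbern (by nlinarith : 0 ≤ (r : ℝ) ^ 2 - r)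
  have h2 := mul_le_mul_of_nonneg_left hthree hk'.le
  nlinarith

theorem tendsto_logb_two_div_atTop : Tendsto (fun t : ℝ => Real.logb 2 t / t) atTop (𝓝 0) := by
  have h := (Real.isLittleO_log_id_atTop.tendsto_div_nhds_zero).div_const (Real.log 2)
  rw [zero_div] at h
  refine h.congr fun t => ?_
  rw [Real.logb, id, div_right_comm]

theorem tendsto_div_of_isLittleO_div_log {n : ℕ → ℕ} {k : ℕ → ℝ} (hn : Tendsto n atTop atTop)
    (hk : k =o[atTop] fun j => (n j : ℝ) / Real.log (n j)) :
    Tendsto (fun j => k j / n j) atTop (𝓝 0) := by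
  have hlog : Tendsto (fun j => Real.log (n j)) atTop atTop :=
    Real.tendsto_log_atTop.comp (tendsto_natCast_atTop_atTop.comp hn)
  have h := hk.tendsto_div_nhds_zero.mul hlog.inv_tendsto_atTop
  rw [zero_mul] at h
  refine h.congr' ?_
  filter_upwards [hlog.eventually_gt_atTop 0] with j hj
  simp only [Pi.inv_apply]
  field_simp

theorem mainTheorem5 (r : ℕ) (P : Fin r → ℝ) (hP : P ∈ stdSimplex ℝ (Fin r))
    (W : Fin r → Fin r → ℝ) (hW : ∀ a, W a ∈ stdSimplex ℝ (Fin r)) :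
    ∃ E : ℝ, IsErrorExponent P W E ∧
      ∀ (n : ℕ) [NeZero n] (D : Finset (ZMod n)), IsDelaySet D →
        ∀ Φ : (ZMod n → Fin r) → (ZMod n → Fin r) → ZMod n, IsMLDecoder W D Φ →
          0 < errorProb P W D Φ ∧
          -(1 / (n : ℝ)) * Real.logb 2 (errorProb P W D Φ) ≤
            E + (maxCycles D : ℝ) / n * (r : ℝ) ^ 2 * Real.logb 2 (1 + (n : ℝ) / maxCycles D)
              - (maxCycles D : ℝ) / n * Real.logb 2 r := by
  have hr := pos_of_mem_stdSimplex hP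
  obtain ⟨l, hl, hb⟩ := exists_base hP hW
  refine ⟨-Real.logb 2 l, ?_, ?_⟩
  · intro n _ D Φ hn hD hκ hΦ
    have hr1 : (1 : ℝ) ≤ r := by exact_mod_cast hr
    have hnpos : ∀ k, (0 : ℝ) < n k := fun k => by exact_mod_cast NeZero.pos (n k)
    have hnR : Tendsto (fun k => (n k : ℝ)) atTop atTop := tendsto_natCast_atTop_atTop.comp hn
    have hlogn := tendsto_logb_two_div_atTop.comp hnR
    have hinv : Tendsto (fun k => ((n k : ℝ))⁻¹) atTop (𝓝 0) := hnR.inv_tendsto_atTop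
    have hcyc := tendsto_div_of_isLittleO_div_log hn hκ
    have hlow : Tendsto (fun k => -Real.logb 2 l - Real.logb 2 (n k) / n k
        - maxRelCycles (D k) / n k * Real.logb 2 r) atTop (𝓝 (-Real.logb 2 l)) := by
      simpa using (hlogn.const_sub (-Real.logb 2 l)).sub (hcyc.mul_const (Real.logb 2 r))
    have hupp : Tendsto (fun k => -Real.logb 2 l + (n k : ℝ)⁻¹
        + ((r : ℝ) ^ 2 - r) * ((n k : ℝ)⁻¹ + Real.logb 2 (n k) / n k))
        atTop (𝓝 (-Real.logb 2 l)) := by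
      simpa using (hinv.const_add (-Real.logb 2 l)).add
        ((hinv.add hlogn).const_mul ((r : ℝ) ^ 2 - r))
    refine tendsto_of_tendsto_of_tendsto_of_le_of_le hlow hupp (fun k => ?_) (fun k => ?_)
    · have hpos := (errorProb_pos_and_neg_logb_le hP hW hl (fun d => (hb _ d).1) (hD k) (Φ k)).1
      have h := logb_errorProb_le hP hW hl (fun d => (hb _ d).2) (hΦ k) hpos
      have := hnpos k
      simp only [finiteExponent]
      rw [← mul_le_mul_iff_of_pos_left this]
      field_simp
      linarith
    · have h := (errorProb_pos_and_neg_logb_le hP hW hl (fun d => (hb _ d).1) (hD k) (Φ k)).2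
      have hnk := hnpos k
      have hn1 : (1 : ℝ) ≤ n k := by exact_mod_cast NeZero.pos (n k)
      have h2 : Real.logb 2 (n k + 1) ≤ 1 + Real.logb 2 (n k) := by
        have h := Real.logb_le_logb_of_le one_lt_two (by positivity)
          (by linarith : (n k + 1 : ℝ) ≤ 2 * n k)
        rwa [Real.logb_mul two_ne_zero hnk.ne', Real.logb_self_eq_one one_lt_two] at h
      have h3 := mul_le_mul_of_nonneg_left h2 (by nlinarith : 0 ≤ (r : ℝ) ^ 2 - r)
      simp only [finiteExponent]
      rw [← mul_le_mul_iff_of_pos_left hnk]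
      field_simp
      linarith
  · intro n _ D hD Φ _
    obtain ⟨hpos, h⟩ := errorProb_pos_and_neg_logb_le hP hW hl (fun d => (hb _ d).1) hD Φ
    refine ⟨hpos, ?_⟩
    obtain ⟨d, -, hd0, hd⟩ := exists_numCycles_eq_maxCycles hD
    have hn : 0 < n := NeZero.pos n
    have hκ : 0 < maxCycles D := by
      have := numCycles_mul_addOrderOf d
      rw [hd] at this
      exact Nat.pos_of_mul_pos_right (this ▸ hn)
    have hle := one_add_logb_le hr hκ (hd ▸ two_mul_numCycles_le hd0)
    have hnR : (0 : ℝ) < n := by exact_mod_cast hn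
    have hkey : -Real.logb 2 (errorProb P W D Φ) ≤ n * -Real.logb 2 l
        + (maxCycles D * (r : ℝ) ^ 2 * Real.logb 2 (1 + n / maxCycles D)
          - maxCycles D * Real.logb 2 r) := by linarith
    calc -(1 / (n : ℝ)) * Real.logb 2 (errorProb P W D Φ)
        = -Real.logb 2 (errorProb P W D Φ) / n := by ring
      _ ≤ (n * -Real.logb 2 l
        + (maxCycles D * (r : ℝ) ^ 2 * Real.logb 2 (1 + n / maxCycles D)
          - maxCycles D * Real.logb 2 r)) / n := div_le_div_of_nonneg_right hkey hnR.le
      _ = _ := by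
        rw [add_div, mul_div_cancel_left₀ _ hnR.ne']
        ring
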